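/- Let $n,m\ge 0$, $\mathbb R[x]=\mathbb R[x_1,\dots,x_n]$ and $g_1,\dots,g_m\in\mathbb R[x]$. Let $\Sigma$ denote the set of sums of squares in $\mathbb R[x]$, and let $M=\Sigma+\Sigma g_1+\dots+\Sigma g_m$ be the quadratic module generated by $g_1,\dots,g_m$. Assume that $M$ is archimedean, i.e. for every $a\in\mathbb R[x]$ there is $k\in\mathbb N$ with $k-a\in M$. Put $X(M)=\{x\in\mathbb R^n : p(x)\ge0 \text{ for all } p\in M\}$. Let $f\in\mathbb R[x]$ with $f\ge 0$ on $X(M)$, and put $Z(f)=\{x\in\mathbb R^n: f(x)=0\}$. Let $V\subseteq\mathbb A^n$ be the (reduced) Zariski closure of $Z(f)\cap X(M)$, and let $J\subseteq\mathbb R[x]$ be its ideal, i.e. the ideal of all polynomials vanishing on $Z(f)\cap X(M)$. Assume that $V$ is a local complete intersection, i.e. for every prime ideal $\mathfrak p\supseteq J$ the localized ideal $J_{\mathfrak p}$ can be generated by $\operatorname{ht}(J_{\mathfrak p})$ elements. For every point $z\in Z(f)\cap X(M)$ assume moreover: 1. $z$ is a nonsingular point of $V$, i.e. the local ring $\mathcal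 O_{V,z}$ is regular; 2. $\nabla f(z)=0$; 3. $D^2f(z)[v,v]>0$ for all $v\in\mathbb R^n$ with $v\notin T_z(V)$, where $D^2f(z)$ is the Hessian of $f$ at $z$ and $T_z(V)=\{v\in\mathbb R^n : \nabla p(z)\cdot v=0 \text{ for all } p\in J\}$. Then $f\in M$. -/

import Mathlib

namespace PolyPos

noncomputable section

open MvPolynomial

/-- The quadratic module `ΣA² + ΣA²·g₁ + ⋯ + ΣA²·g_m` generated by `g₁, …, g_m` in `A`. -/
def QM {A : Type*} [CommRing A] {m : ℕ} (g : Fin m → A) : Set A :=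
  {p | ∃ (s₀ : A) (s : Fin m → A), IsSumSq s₀ ∧ (∀ i, IsSumSq (s i)) ∧
    p = s₀ + ∑ i, s i * g i}

/-- A subset `M` of a ring `A` is archimedean if for every `a` in `A` there is a natural
number `k` with `k - a ∈ M`. -/
def IsArchimedean {A : Type*} [CommRing A] (M : Set A) : Prop :=
  ∀ a : A, ∃ k : ℕ, (k : A) - a ∈ M

/-- The set `X(M)` of points of `ℝⁿ` at which all elements of `M` are nonnegative. -/
def nonnegSet {n : ℕ} (M : Set (MvPolynomial (Fin n) ℝ)) : Set (Fin n → ℝ) :=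
  {x | ∀ p ∈ M, 0 ≤ eval x p}

/-- The real zero set `Z(f)` of the polynomial `f`. -/
def zeroSet {n : ℕ} (f : MvPolynomial (Fin n) ℝ) : Set (Fin n → ℝ) :=
  {x | eval x f = 0}

/-- The ideal of all polynomials vanishing on `S`. It is the ideal of the (reduced) Zariski
closure of `S` in affine `n`-space. -/
def closureIdeal {n : ℕ} (S : Set (Fin n → ℝ)) : Ideal (MvPolynomial (Fin n) ℝ) :=
  vanishingIdeal ℝ S

/-- The closed subscheme `Spec (A ⧸ J)` of `Spec A` is a local complete intersection (in `Spec A`):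
at every point `p` of it, the localized ideal `J_p` can be generated by as many elements as its
height. For `A = ℝ[x₁, …, xₙ]` that height is the local codimension of the subscheme at `p`. -/
def IsLocalCompleteIntersection {A : Type*} [CommRing A] (J : Ideal A) : Prop :=
  ∀ (p : Ideal A) [p.IsPrime], J ≤ p →
    ∃ (r : ℕ) (a : Fin r → Localization.AtPrime p),
      Ideal.span (Set.range a) = J.map (algebraMap A (Localization.AtPrime p)) ∧
      (r : ℕ∞) = (J.map (algebraMap A (Localization.AtPrime p))).height

/-- The maximal ideal of all polynomials vanishing at the real point `z`. -/
def pointIdeal {n : ℕ} (z : Fin n → ℝ) : Ideal (MvPolynomial (Fin n) ℝ) :=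
  RingHom.ker (eval z)

instance pointIdeal_isPrime {n : ℕ} (z : Fin n → ℝ) : (pointIdeal z).IsPrime :=
  RingHom.ker_isPrime (eval z)

/-- `z` is a nonsingular point of the subscheme of affine space with ideal `J`: the local ring
`𝒪_{V,z} = ℝ[x]_𝔪 ⧸ J ℝ[x]_𝔪`, with `𝔪` the maximal ideal of `z`, is a regular local ring. -/
def IsNonsingularAt {n : ℕ} (J : Ideal (MvPolynomial (Fin n) ℝ)) (z : Fin n → ℝ) : Prop :=
  IsRegularLocalRing (Localization.AtPrime (pointIdeal z) ⧸
    J.map (algebraMap (MvPolynomial (Fin n) ℝ) (Localization.AtPrime (pointIdeal z))))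

/-- The gradient `∇f(z)`. -/
def grad {n : ℕ} (f : MvPolynomial (Fin n) ℝ) (z : Fin n → ℝ) : Fin n → ℝ :=
  fun i => eval z (pderiv i f)

/-- The Hessian matrix of `f` at `z`. -/
def hessian {n : ℕ} (f : MvPolynomial (Fin n) ℝ) (z : Fin n → ℝ) :
    Matrix (Fin n) (Fin n) ℝ :=
  Matrix.of fun i j => eval z (pderiv i (pderiv j f))

/-- The value `D²f(z)[v, w]` of the Hessian of `f` at `z` on the pair `(v, w)`. -/
def D2 {n : ℕ} (f : MvPolynomial (Fin n) ℝ) (z v w : Fin n → ℝ) : ℝ :=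
  v ⬝ᵥ (hessian f z).mulVec w

/-- The tangent space at `z` of the subscheme of affine space with ideal `J`, as a linear subspace
of `ℝⁿ`: all `v` with `∇p(z) · v = 0` for every `p ∈ J`. -/
def tangentSpace {n : ℕ} (J : Ideal (MvPolynomial (Fin n) ℝ)) (z : Fin n → ℝ) :
    Submodule ℝ (Fin n → ℝ) where
  carrier := {v | ∀ p ∈ J, grad p z ⬝ᵥ v = 0}
  zero_mem' := fun p _ => dotProduct_zero _
  add_mem' := fun {v w} hv hw p hp => by
    rw [dotProduct_add, hv p hp, hw p hp, add_zero]
  smul_mem' := fun c v hv p hp => by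
    rw [dotProduct_smul, hv p hp, smul_zero]

end

end PolyPos

/-! The proof is a local-global argument with pure states of the ideal `J ^ 2`. The hypotheses on
`V` and the vanishing of `f` and its gradient on `Z(f) ∩ X(M)` force `f ∈ J ^ 2`
(`mem_sq_of_grad_eq_zero`): locally `J` is generated by `F₁, …, F_r` with independent gradients, so
the coefficients of `f` along the `F_i` vanish on `Z(f) ∩ X(M)`. Since `M` is archimedean, the sum
of squares `u` of generators of `J` is an order unit of `J ^ 2` for the cone `M ∩ J ^ 2`. If `f ∉
M`, separation and Krein–Milman give a pure state `φ` with `φ f ≤ 0`. Purity makes `φ`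
multiplicative, `φ (a b) = a(z) φ b` for a point `z ∈ X(M)` (`exists_multiplicative_state_nonpos`),
and evaluating `φ (f u)` in two ways shows `f(z) = 0`. Near `z`, `f` is a quadratic form in the
`F_i` whose coefficient matrix at `z` is half the Hessian in normal directions, hence positive
definite, while `(φ (F_i F_j))` is positive semidefinite and nonzero. The trace pairing of the two
is positive, so `φ f > 0` (`state_pos_of_hessian`), a contradiction. -/

namespace PolyPos
-- States and pure states of a cone with order unit.
section PureStates

variable {E : Type*} [AddCommGroup E] [Module ℝ E]

/-- The states of `(E, C, u)`, as a set of functions: the linear functionals which are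
nonnegative on the cone `C` and take the value `1` at `u`. -/
def stateSet (C : PointedCone ℝ E) (u : E) : Set (E → ℝ) :=
  {F | (∀ x y, F (x + y) = F x + F y) ∧ (∀ (c : ℝ) x, F (c • x) = c * F x) ∧
    (∀ x ∈ C, 0 ≤ F x) ∧ F u = 1}

/-- The order unit confines each value `F x` to a fixed interval, so the states form a closed subset
of a product of compact intervals (Tychonoff). -/
theorem isCompact_stateSet (C : PointedCone ℝ E) (u : E)
    (hunit : ∀ x : E, ∃ N : ℝ, N • u - x ∈ C) : IsCompact (stateSet C u) := by
  choose N hN using hunit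
  refine IsCompact.of_isClosed_subset
    (isCompact_univ_pi fun x => isCompact_Icc (a := -N (-x)) (b := N x)) ?_ ?_
  · have h : stateSet C u = (⋂ x, ⋂ y, {F : E → ℝ | F (x + y) = F x + F y}) ∩
        ((⋂ c : ℝ, ⋂ x, {F : E → ℝ | F (c • x) = c * F x}) ∩
        ((⋂ x ∈ C, {F : E → ℝ | 0 ≤ F x}) ∩ {F : E → ℝ | F u = 1})) := by
      ext F
      simp [stateSet]
    rw [h]
    refine IsClosed.inter ?_ (IsClosed.inter ?_ (IsClosed.inter ?_ ?_))
    · exact isClosed_iInter fun x => isClosed_iInter fun y =>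
        isClosed_eq (by fun_prop) (by fun_prop)
    · exact isClosed_iInter fun x => isClosed_iInter fun y =>
        isClosed_eq (by fun_prop) (by fun_prop)
    · exact isClosed_biInter fun x _ => isClosed_le (by fun_prop) (by fun_prop)
    · exact isClosed_eq (by fun_prop) (by fun_prop)
  · rintro F ⟨hadd, hsmul, hpos, hu⟩ x -
    have hneg : ∀ y, F (-y) = -F y := fun y => by
      have := hsmul (-1) y
      simpa using this
    have key : ∀ y, F y ≤ N y := fun y => by
      have := hpos _ (hN y)
      rw [sub_eq_add_neg, hadd, hsmul, hu, hneg] at this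
      linarith
    have h1 := key (-x)
    rw [hneg] at h1
    exact ⟨by linarith, key x⟩

/-- A vector outside a pointed cone with order unit is separated from it by a state. -/
theorem exists_state_nonpos (C : PointedCone ℝ E) (u : E) (huC : u ∈ C)
    (hunit : ∀ x : E, ∃ N : ℝ, N • u - x ∈ C) {f : E} (hf : f ∉ C) :
    ∃ φ : E →ₗ[ℝ] ℝ, (∀ x ∈ C, 0 ≤ φ x) ∧ φ u = 1 ∧ φ f ≤ 0 := by
  have hmul : ∀ {c : ℝ} {x : E}, 0 ≤ c → x ∈ C → c • x ∈ C := fun {c x} hc hx =>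
    C.smul_mem hc hx
  have hneg : -u ∉ C := by
    intro h
    obtain ⟨N, hN⟩ := hunit (-f)
    apply hf
    rcases le_total 0 N with h0 | h0
    · have := C.add_mem hN (hmul h0 h)
      simpa using this
    · have := C.add_mem hN (hmul (neg_nonneg.2 h0) huC)
      simpa using this
  -- Adjoining `-f` keeps the cone proper, and a state of the larger cone is automatically
  -- nonpositive at `f`.
  let C' : PointedCone ℝ E := C ⊔ Submodule.span {c : ℝ // 0 ≤ c} {-f}
  have hC' : ∀ x, x ∈ C' ↔ ∃ t : ℝ, 0 ≤ t ∧ x + t • f ∈ C := by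
    intro x
    simp only [C', Submodule.mem_sup, Submodule.mem_span_singleton]
    constructor
    · rintro ⟨y, hy, z, ⟨a, rfl⟩, rfl⟩
      refine ⟨a, a.2, ?_⟩
      have : y + a • -f + (a : ℝ) • f = y := by
        change y + (a : ℝ) • -f + (a : ℝ) • f = y
        simp
      rwa [this]
    · rintro ⟨t, ht, h⟩
      refine ⟨_, h, _, ⟨(⟨t, ht⟩ : {c : ℝ // 0 ≤ c}), rfl⟩, ?_⟩
      change x + t • f + t • -f = x
      simp
  have hu' : -u ∉ C' := by
    rw [hC']
    rintro ⟨t, ht, h⟩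
    rcases ht.eq_or_lt with rfl | ht
    · exact hneg (by simpa using h)
    · apply hf
      have := hmul (inv_nonneg.2 ht.le) (C.add_mem h huC)
      simpa [smul_smul, ht.ne'] using this
  have hu0 : u ≠ 0 := by
    rintro rfl
    exact hu' (by simp)
  have hle : C ≤ C' := le_sup_left
  let L : E →ₗ.[ℝ] ℝ := LinearPMap.mkSpanSingleton u (1 : ℝ) hu0
  have hnonneg : ∀ x : L.domain, (x : E) ∈ C' →
      0 ≤ L x := by
    rintro ⟨x, hx⟩ hxC
    obtain ⟨t, rfl⟩ := Submodule.mem_span_singleton.1 hx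
    have : L ⟨t • u, hx⟩ = t := by
      refine (LinearPMap.mkSpanSingleton'_apply u (1 : ℝ) _ t hx).trans (by simp)
    rw [this]
    by_contra! ht
    apply hu'
    have h2 := C'.smul_mem (r := (-t)⁻¹) (inv_nonneg.2 (by linarith)) hxC
    have h3 : (-t)⁻¹ • t • u = -u := by
      rw [smul_smul]
      have : (-t)⁻¹ * t = -1 := by rw [inv_neg, neg_mul, inv_mul_cancel₀ ht.ne]
      rw [this, neg_one_smul]
    rw [← h3]
    exact h2
  have hdense : ∀ y : E, ∃ x : L.domain,
      (x : E) + y ∈ C' := by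
    intro y
    obtain ⟨N, hN⟩ := hunit (-y)
    exact ⟨⟨N • u, Submodule.mem_span_singleton.2 ⟨N, rfl⟩⟩, hle (by simpa using hN)⟩
  obtain ⟨φ, hφ, hpos⟩ := riesz_extension C' _ hnonneg hdense
  refine ⟨φ, fun x hx => hpos x (hle hx), ?_, ?_⟩
  · rw [hφ ⟨u, Submodule.mem_span_singleton_self u⟩]
    exact LinearPMap.mkSpanSingleton'_apply_self u (1 : ℝ) _ _
  · have := hpos (-f) ((hC' _).2 ⟨1, zero_le_one, by simp⟩)
    simpa using this

/-- A vector outside a pointed cone with order unit is separated from it by a pure state. -/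
theorem exists_pure_state_nonpos (C : PointedCone ℝ E) (u : E) (huC : u ∈ C)
    (hunit : ∀ x : E, ∃ N : ℝ, N • u - x ∈ C) {f : E} (hf : f ∉ C) :
    ∃ φ : E →ₗ[ℝ] ℝ, (∀ x ∈ C, 0 ≤ φ x) ∧ φ u = 1 ∧ φ f ≤ 0 ∧
      ∀ ψ : E →ₗ[ℝ] ℝ, (∀ x ∈ C, 0 ≤ ψ x) → (∀ x ∈ C, ψ x ≤ φ x) →
        ∀ x, ψ x = ψ u * φ x := by
  obtain ⟨φ₀, h1, h2, h3⟩ := exists_state_nonpos C u huC hunit hf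
  have hcpt := isCompact_stateSet C u hunit
  have hmem : ∀ φ : E →ₗ[ℝ] ℝ, (∀ x ∈ C, 0 ≤ φ x) → φ u = 1 →
      (φ : E → ℝ) ∈ stateSet C u := fun φ h h' =>
    ⟨map_add φ, fun c x => by simp, h, h'⟩
  obtain ⟨F₀, hF₀, hmin⟩ := hcpt.exists_isMinOn ⟨_, hmem φ₀ h1 h2⟩
    (continuous_apply f).continuousOn
  have hmin' : ∀ F ∈ stateSet C u, F₀ f ≤ F f := fun F hF => hmin hF
  have hcl : IsClosed {F : E → ℝ | F f ≤ F₀ f} := isClosed_le (by fun_prop) (by fun_prop)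
  -- The minimizers of evaluation at `f` form a face of the state space, so an extreme point of this
  -- face is also extreme among all states.
  obtain ⟨F, hF⟩ := (hcpt.inter_right hcl).extremePoints_nonempty ⟨F₀, hF₀, le_refl (F₀ f)⟩
  rw [mem_extremePoints] at hF
  obtain ⟨⟨⟨hadd, hsmul, hpos, hu⟩, hFf⟩, hext⟩ := hF
  let φ : E →ₗ[ℝ] ℝ := { toFun := F, map_add' := hadd, map_smul' := hsmul }
  have hφF : (φ : E → ℝ) = F := rfl
  refine ⟨φ, hpos, hu, ?_, ?_⟩
  · exact le_trans hFf (le_trans (hmin' _ (hmem φ₀ h1 h2)) h3)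
  · intro ψ hψ hψφ x
    have ht : ψ u ≤ 1 := by have := hψφ u huC; rw [hφF, hu] at this; exact this
    have ht0 : 0 ≤ ψ u := hψ u huC
    -- From `0 ≤ ψ ≤ φ` on `C` and `0 ≤ ψ u ≤ 1`, both `φ + δ` and `φ - δ` are states with midpoint
    -- `φ`; minimality at `f` puts both in the face, and extremality forces `δ = 0`.
    let δ : E →ₗ[ℝ] ℝ := (1 / 2 : ℝ) • (ψ - ψ u • φ)
    have hδ : ∀ y, δ y = (ψ y - ψ u * φ y) / 2 := fun y => by
      simp only [δ, LinearMap.smul_apply, LinearMap.sub_apply, smul_eq_mul]; ring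
    have hδu : δ u = 0 := by rw [hδ, hφF, hu]; ring
    have hp1 : (⇑(φ + δ) : E → ℝ) ∈ stateSet C u := by
      apply hmem
      · intro y hy
        rw [LinearMap.add_apply, hδ]
        nlinarith [hψ y hy, hψφ y hy, mul_le_mul_of_nonneg_right ht (hpos y hy)]
      · rw [LinearMap.add_apply, hδu, hφF, hu]; ring
    have hp2 : (⇑(φ - δ) : E → ℝ) ∈ stateSet C u := by
      apply hmem
      · intro y hy
        rw [LinearMap.sub_apply, hδ]
        nlinarith [hψ y hy, hψφ y hy, mul_nonneg ht0 (hpos y hy)]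
      · rw [LinearMap.sub_apply, hδu, hφF, hu]; ring
    have hf1 := hmin' _ hp1
    have hf2 := hmin' _ hp2
    have hFf' : φ f ≤ F₀ f := hFf
    rw [LinearMap.add_apply] at hf1
    rw [LinearMap.sub_apply] at hf2
    have h := hext _ ⟨hp1, by simp only [Set.mem_ofPred_eq, LinearMap.add_apply]; linarith⟩ _
      ⟨hp2, by simp only [Set.mem_ofPred_eq, LinearMap.sub_apply]; linarith⟩
      ⟨1 / 2, 1 / 2, by norm_num, by norm_num, by norm_num, ?_⟩
    · have h4 := congrFun h.1 x
      rw [LinearMap.add_apply, hδ] at h4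
      have : F x = φ x := rfl
      linarith
    · funext y
      simp only [Pi.add_apply, Pi.smul_apply, LinearMap.add_apply, LinearMap.sub_apply,
        smul_eq_mul]
      have : F y = φ y := rfl
      linarith

end PureStates
end PolyPos

/-! ### Quadratic modules, order units and moment growth. -/

namespace PolyPos
section QuadraticModules

/-- Quadratic modules of a commutative ring. -/
structure IsQuadraticModule {A : Type*} [CommRing A] (M : Set A) : Prop where
  one_mem : 1 ∈ M
  add_mem : ∀ {p q}, p ∈ M → q ∈ M → p + q ∈ M
  sq_mul_mem : ∀ (a) {p}, p ∈ M → a ^ 2 * p ∈ M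

theorem isQuadraticModule_QM {A : Type*} [CommRing A] {m : ℕ} (g : Fin m → A) :
    IsQuadraticModule (QM g) where
  one_mem := ⟨1, fun _ => 0, IsSumSq.one, fun _ => IsSumSq.zero, by simp⟩
  add_mem := by
    rintro p q ⟨s₀, s, h₀, h, rfl⟩ ⟨t₀, t, k₀, k, rfl⟩
    refine ⟨s₀ + t₀, fun i => s i + t i, h₀.add k₀, fun i => (h i).add (k i), ?_⟩
    simp only [add_mul, Finset.sum_add_distrib]
    ring
  sq_mul_mem := by
    rintro a p ⟨s₀, s, h₀, h, rfl⟩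
    have ha : IsSumSq (a ^ 2) := (IsSquare.sq a).isSumSq
    refine ⟨a ^ 2 * s₀, fun i => a ^ 2 * s i, ha.mul h₀, fun i => ha.mul (h i), ?_⟩
    simp only [mul_add, Finset.mul_sum, mul_assoc]

variable {A : Type*} [CommRing A] {M : Set A}

namespace IsQuadraticModule

theorem sq_mem (hM : IsQuadraticModule M) (a : A) : a ^ 2 ∈ M := by
  simpa using hM.sq_mul_mem a hM.one_mem

theorem zero_mem (hM : IsQuadraticModule M) : (0 : A) ∈ M := by
  simpa using hM.sq_mem 0

theorem sum_mem (hM : IsQuadraticModule M) {ι : Type*} (s : Finset ι) {p : ι → A}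
    (hp : ∀ i ∈ s, p i ∈ M) : ∑ i ∈ s, p i ∈ M := by
  classical
  induction s using Finset.induction_on with
  | empty => simpa using hM.zero_mem
  | insert i s hi ih =>
    rw [Finset.sum_insert hi]
    exact hM.add_mem (hp i (by simp)) (ih fun j hj => hp j (by simp [hj]))

variable [Algebra ℝ A]

theorem smul_mem (hM : IsQuadraticModule M) {c : ℝ} (hc : 0 ≤ c) {p : A} (hp : p ∈ M) :
    c • p ∈ M := by
  have h := hM.sq_mul_mem (algebraMap ℝ A (Real.sqrt c)) hp
  rwa [← map_pow, Real.sq_sqrt hc, ← Algebra.smul_def] at h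

/-- The trace of a quadratic module on an ideal, as a pointed cone. -/
def cone (hM : IsQuadraticModule M) (I : Ideal A) : PointedCone ℝ I where
  carrier := {b | (b : A) ∈ M}
  add_mem' := fun ha hb => hM.add_mem ha hb
  zero_mem' := hM.zero_mem
  smul_mem' := fun c _ hb => hM.smul_mem c.2 hb

theorem mem_cone (hM : IsQuadraticModule M) {I : Ideal A} {b : I} :
    b ∈ hM.cone I ↔ (b : A) ∈ M := Iff.rfl

/-- Induction on the number of terms, from `(a + b)² ≤ 2a² + 2b²` and `c² h² ≤ k h²`, the latter
because `k - c² ∈ M` may be multiplied by the square `h²`. -/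
theorem exists_smul_sub_sq_mem (hM : IsQuadraticModule M) (harch : IsArchimedean M)
    {ι : Type*} [Fintype ι] (h : ι → A) {x : A} (hx : x ∈ Ideal.span (Set.range h)) :
    ∃ N : ℝ, 0 ≤ N ∧ N • ∑ i, h i ^ 2 - x ^ 2 ∈ M := by
  have hnonneg : ∀ {c : ℝ}, 0 ≤ c → ∀ i, c • h i ^ 2 ∈ M := fun hc i =>
    hM.smul_mem hc (hM.sq_mem _)
  obtain ⟨c, rfl⟩ := Ideal.mem_span_range_iff_exists_fun.1 hx
  have key : ∀ s : Finset ι, ∃ N : ℝ, 0 ≤ N ∧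
      N • ∑ i, h i ^ 2 - (∑ i ∈ s, c i * h i) ^ 2 ∈ M := by
    classical
    intro s
    induction s using Finset.induction_on with
    | empty => exact ⟨0, le_rfl, by simpa using hM.zero_mem⟩
    | insert i s hi ih =>
      obtain ⟨N, hN0, hN⟩ := ih
      obtain ⟨k, hk⟩ := harch (c i ^ 2)
      refine ⟨2 * N + 2 * k, by positivity, ?_⟩
      rw [Finset.sum_insert hi]
      set y := ∑ i ∈ s, c i * h i
      set U := ∑ i, h i ^ 2 with hU
      have h1 : (2 : ℝ) • (N • U - y ^ 2) ∈ M := hM.smul_mem zero_le_two hN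
      have h2 : (2 : ℝ) • (h i ^ 2 * ((k : A) - c i ^ 2)) ∈ M :=
        hM.smul_mem zero_le_two (hM.sq_mul_mem _ hk)
      have h3 : (2 * k : ℝ) • ∑ j ∈ Finset.univ.erase i, h j ^ 2 ∈ M :=
        hM.smul_mem (by positivity) (hM.sum_mem _ fun j _ => hM.sq_mem _)
      have h4 : U = h i ^ 2 + ∑ j ∈ Finset.univ.erase i, h j ^ 2 :=
        (Finset.add_sum_erase _ _ (Finset.mem_univ i)).symm
      have h5 := hM.add_mem (hM.add_mem h1 h2) (hM.add_mem h3 (hM.sq_mem (c i * h i - y)))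
      convert h5 using 1
      have h6 : ∑ j ∈ Finset.univ.erase i, h j ^ 2 = U - h i ^ 2 := by rw [h4]; ring
      rw [h6]
      simp only [Algebra.smul_def, map_add, map_mul, map_ofNat, map_natCast]
      ring
  simpa using key Finset.univ

/-- The order unit property of `∑ h i ^ 2`. Products reduce to squares by `4xy = (x + y)² - (x -
y)²`. -/
theorem exists_smul_sub_mem (hM : IsQuadraticModule M) (harch : IsArchimedean M)
    {ι : Type*} [Fintype ι] (h : ι → A) {b : A} (hb : b ∈ Ideal.span (Set.range h) ^ 2) :
    ∃ N : ℝ, N • ∑ i, h i ^ 2 - b ∈ M := by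
  rw [pow_two] at hb
  refine Submodule.mul_induction_on hb ?_ ?_
  · intro x hx y hy
    obtain ⟨N, -, hN⟩ := hM.exists_smul_sub_sq_mem harch h (Ideal.add_mem _ hx hy)
    refine ⟨1 / 4 * N, ?_⟩
    have h1 := hM.smul_mem (c := 1 / 4) (by norm_num) (hM.add_mem hN (hM.sq_mem (x - y)))
    convert h1 using 1
    rw [smul_add, smul_sub, smul_smul]
    have h4 : ((1 / 4 : ℝ) • (4 * (x * y)) : A) = x * y := by
      rw [Algebra.smul_def, ← mul_assoc, ← map_ofNat (algebraMap ℝ A) 4, ← map_mul]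
      norm_num
    have h5 : (4 * (x * y) : A) = (x + y) ^ 2 - (x - y) ^ 2 := by ring
    rw [← h4, h5, smul_sub]
    abel
  · rintro x y ⟨N, hN⟩ ⟨K, hK⟩
    refine ⟨N + K, ?_⟩
    convert hM.add_mem hN hK using 1
    rw [add_smul]
    abel

end IsQuadraticModule

/-- A moment sequence of at most exponential growth of rate `K` satisfies `|x₁| ≤ K m`, where `m`
is the zeroth moment and `x i` the moment of order `2 ^ i`. -/
theorem abs_le_of_sq_le_of_growth {x : ℕ → ℝ} {m c K : ℝ} (hm : 0 ≤ m) (hK : 0 < K)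
    (hcs : ∀ i, x i ^ 2 ≤ m * x (i + 1)) (hgr : ∀ i, x (i + 1) ≤ c * K ^ 2 ^ (i + 1)) :
    |x 0| ≤ K * m := by
  rcases hm.eq_or_lt with rfl | hm
  · have h := hcs 0
    have : x 0 = 0 := by nlinarith
    simp [this]
  by_contra! hlt
  -- Iterating `x i ^ 2 ≤ m * x (i + 1)` would give `|x i| ≥ m (K θ) ^ 2 ^ i`, which for `θ > 1`
  -- outgrows `c * K ^ 2 ^ i`.
  set θ := |x 0| / (K * m) with hθ
  have hθ1 : 1 < θ := by rwa [hθ, one_lt_div (by positivity)]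
  have key : ∀ i, m * K ^ 2 ^ i * θ ^ 2 ^ i ≤ |x i| := by
    intro i
    induction i with
    | zero =>
      have : K * m * θ = |x 0| := by rw [hθ]; field_simp
      simp only [pow_zero, pow_one]
      linarith
    | succ i ih =>
      have h1 : (m * K ^ 2 ^ i * θ ^ 2 ^ i) ^ 2 ≤ |x i| ^ 2 :=
        pow_le_pow_left₀ (by positivity) ih 2
      rw [sq_abs] at h1
      have h2 := h1.trans (hcs i)
      have h3 : (m * K ^ 2 ^ i * θ ^ 2 ^ i) ^ 2
          = m * (m * K ^ 2 ^ (i + 1) * θ ^ 2 ^ (i + 1)) := by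
        rw [pow_succ 2 i, pow_mul, pow_mul]; ring
      rw [h3] at h2
      exact (le_of_mul_le_mul_left h2 hm).trans (le_abs_self _)
  obtain ⟨N, hN⟩ := pow_unbounded_of_one_lt (c / m) hθ1
  have h1 := key (N + 1)
  have hpos : 0 ≤ x (N + 1) := by
    have := (sq_nonneg (x N)).trans (hcs N)
    exact nonneg_of_mul_nonneg_right this hm
  rw [abs_of_nonneg hpos] at h1
  have h2 := h1.trans (hgr N)
  have hKp : 0 < K ^ 2 ^ (N + 1) := by positivity
  have h3 : m * θ ^ 2 ^ (N + 1) ≤ c := by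
    refine le_of_mul_le_mul_right ?_ hKp
    linarith
  have h4 : θ ^ N ≤ θ ^ 2 ^ (N + 1) :=
    pow_le_pow_right₀ hθ1.le ((Nat.lt_two_pow_self).le.trans (Nat.pow_le_pow_right two_pos (by simp)))
  rw [div_lt_iff₀ hm] at hN
  nlinarith

section States

variable [Algebra ℝ A] {I : Ideal A}

theorem coe_real_smul (c : ℝ) (b : I) : ((c • b : I) : A) = algebraMap ℝ A c * b :=
  Algebra.smul_def c (b : A)

/-- The quadratic polynomial `t ↦ φ ((a + t)² b)` is nonnegative, so its discriminant is not
positive. -/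
theorem state_cauchySchwarz (hM : IsQuadraticModule M) {φ : I →ₗ[ℝ] ℝ}
    (hφ : ∀ b : I, (b : A) ∈ M → 0 ≤ φ b) (a : A) {b : I} (hb : (b : A) ∈ M) :
    φ (a • b) ^ 2 ≤ φ b * φ (a ^ 2 • b) := by
  have h : ∀ t : ℝ, 0 ≤ φ b * (t * t) + 2 * φ (a • b) * t + φ (a ^ 2 • b) := by
    intro t
    have h1 := hφ ((a + algebraMap ℝ A t) ^ 2 • b)
      (by simpa using hM.sq_mul_mem (a + algebraMap ℝ A t) hb)
    have h2 : (a + algebraMap ℝ A t) ^ 2 • b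
        = a ^ 2 • b + (2 * t) • (a • b) + (t * t) • b := by
      ext
      simp only [coe_real_smul, Submodule.coe_smul, Submodule.coe_add, smul_eq_mul, map_mul,
        map_ofNat]
      ring
    rw [h2, map_add, map_add, φ.map_smul, φ.map_smul, smul_eq_mul, smul_eq_mul] at h1
    linarith
  have := discrim_le_zero h
  rw [discrim] at this
  linarith

/-- For `b = x²` the bound holds because `(a ^ j x)² (K² - a²) ∈ M`; polarization extends it to `J ^
2`. The rate `K` does not depend on `b`; only the constant `c` does. -/
theorem state_growth (hM : IsQuadraticModule M) {J : Ideal A} {φ : ↥(J ^ 2) →ₗ[ℝ] ℝ}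
    (hφ : ∀ b : ↥(J ^ 2), (b : A) ∈ M → 0 ≤ φ b) {a : A} {K : ℝ}
    (ha : algebraMap ℝ A (K ^ 2) - a ^ 2 ∈ M) (b : ↥(J ^ 2)) :
    ∃ c : ℝ, ∀ j, φ (a ^ (2 * j) • b) ≤ c * K ^ (2 * j) := by
  have hsq : ∀ {x}, x ∈ J → x ^ 2 ∈ J ^ 2 := fun hx => Ideal.pow_mem_pow hx 2
  have key : ∀ x (hx : x ∈ J), ∀ j, 0 ≤ φ (a ^ (2 * j) • ⟨x ^ 2, hsq hx⟩) ∧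
      φ (a ^ (2 * j) • ⟨x ^ 2, hsq hx⟩) ≤ φ ⟨x ^ 2, hsq hx⟩ * K ^ (2 * j) := by
    intro x hx j
    constructor
    · apply hφ
      have := hM.sq_mem (a ^ j * x)
      rw [mul_pow, ← pow_mul, mul_comm j] at this
      exact this
    induction j with
    | zero => simp
    | succ j ih =>
      have h1 := hφ ((a ^ (2 * j) * (algebraMap ℝ A (K ^ 2) - a ^ 2)) • ⟨x ^ 2, hsq hx⟩) (by
        have := hM.sq_mul_mem (a ^ j * x) ha
        convert this using 1
        change a ^ (2 * j) * (algebraMap ℝ A (K ^ 2) - a ^ 2) * x ^ 2 = _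
        ring)
      have h2 : (a ^ (2 * j) * (algebraMap ℝ A (K ^ 2) - a ^ 2)) • (⟨x ^ 2, hsq hx⟩ : ↥(J ^ 2))
          = K ^ 2 • (a ^ (2 * j) • ⟨x ^ 2, hsq hx⟩) - a ^ (2 * (j + 1)) • ⟨x ^ 2, hsq hx⟩ := by
        ext
        simp only [coe_real_smul, Submodule.coe_smul, Submodule.coe_sub, smul_eq_mul]
        ring
      rw [h2, map_sub, map_smul, smul_eq_mul] at h1
      have h3 := mul_le_mul_of_nonneg_left ih (sq_nonneg K)
      have h4 : K ^ (2 * (j + 1)) = K ^ 2 * K ^ (2 * j) := by ring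
      rw [h4]
      linarith
  obtain ⟨b, hb⟩ := b
  have hb' := hb
  rw [pow_two] at hb'
  have hJ : J * J ≤ J ^ 2 := (pow_two J).ge
  refine Submodule.mul_induction_on' (C := fun b hb => ∃ c : ℝ, ∀ j : ℕ,
    φ (a ^ (2 * j) • ⟨b, hJ hb⟩) ≤ c * K ^ (2 * j)) ?_ ?_ hb'
  · intro x hx y hy
    have hxy := J.add_mem hx hy
    have hxy' := J.sub_mem hx hy
    refine ⟨1 / 4 * φ ⟨_, hsq hxy⟩, fun j => ?_⟩
    have h1 : (4 : ℝ) • (a ^ (2 * j) • (⟨x * y, hJ (Ideal.mul_mem_mul hx hy)⟩ : ↥(J ^ 2)))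
        = a ^ (2 * j) • ⟨_, hsq hxy⟩ - a ^ (2 * j) • ⟨_, hsq hxy'⟩ := by
      ext
      simp only [coe_real_smul, Submodule.coe_smul, Submodule.coe_sub, smul_eq_mul, map_ofNat]
      ring
    have h2 := congrArg φ h1
    rw [map_smul, map_sub, smul_eq_mul] at h2
    linarith [(key _ hxy j).2, (key _ hxy' j).1]
  · rintro x hx y hy ⟨c, hc⟩ ⟨d, hd⟩
    refine ⟨c + d, fun j => ?_⟩
    have h1 : a ^ (2 * j) • (⟨x + y, hJ (add_mem hx hy)⟩ : ↥(J ^ 2))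
        = a ^ (2 * j) • ⟨x, hJ hx⟩ + a ^ (2 * j) • ⟨y, hJ hy⟩ := by
      rw [← smul_add]
      rfl
    rw [h1, map_add, add_mul]
    exact add_le_add (hc j) (hd j)

end States

end QuadraticModules
end PolyPos

/-! ### Multiplicativity of pure states on the square of an ideal. -/

namespace PolyPos
section PureStateIdeal

variable {A : Type*} [CommRing A] [Algebra ℝ A] {M : Set A}

/-- `M` need not be closed under products, so `(K - a) b ∈ M` is not available for `b ∈ M`. Instead
Cauchy–Schwarz along the powers `a ^ 2 ^ i`, with the growth bound, removes the constant depending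
on `b`. -/
theorem exists_abs_state_smul_le (hM : IsQuadraticModule M) (harch : IsArchimedean M)
    {J : Ideal A} {φ : ↥(J ^ 2) →ₗ[ℝ] ℝ} (hφ : ∀ b : ↥(J ^ 2), (b : A) ∈ M → 0 ≤ φ b) (a : A) :
    ∃ K : ℝ, 0 < K ∧ ∀ b : ↥(J ^ 2), (b : A) ∈ M → |φ (a • b)| ≤ K * φ b := by
  obtain ⟨k, hk⟩ := harch (a ^ 2)
  have hK2 : Real.sqrt (k + 1) ^ 2 = k + 1 := Real.sq_sqrt (by positivity)
  have hK : 0 < Real.sqrt (k + 1 : ℝ) := Real.sqrt_pos.2 (by positivity)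
  have ha : algebraMap ℝ A (Real.sqrt (k + 1) ^ 2) - a ^ 2 ∈ M := by
    rw [hK2]
    convert hM.add_mem hk hM.one_mem using 1
    simp only [map_add, map_natCast, map_one]
    ring
  refine ⟨_, hK, fun b hb => ?_⟩
  obtain ⟨c, hc⟩ := state_growth hM hφ ha b
  have := abs_le_of_sq_le_of_growth (x := fun i => φ (a ^ 2 ^ i • b)) (hφ b hb) hK
    (fun i => ?_) (fun i => ?_) (c := c)
  · simpa using this
  · have := state_cauchySchwarz hM hφ (a ^ 2 ^ i) hb
    rwa [← pow_mul, ← pow_succ] at this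
  · have := hc (2 ^ i)
    rwa [mul_comm, ← pow_succ] at this

/-- If `f ∈ J ^ 2` is not in the archimedean quadratic module `M`, then some pure state of
`J ^ 2` is nonpositive at `f`, and it is multiplicative over a point of `X(M)`. -/
theorem exists_multiplicative_state_nonpos (hM : IsQuadraticModule M) (harch : IsArchimedean M)
    {ι : Type*} [Fintype ι] {J : Ideal A} (h : ι → A) (hJ : J = Ideal.span (Set.range h))
    {f : A} (hfJ : f ∈ J ^ 2) (hf : f ∉ M) :
    ∃ (φ : ↥(J ^ 2) →ₗ[ℝ] ℝ) (Φ : A →ₐ[ℝ] ℝ), (∀ b : ↥(J ^ 2), (b : A) ∈ M → 0 ≤ φ b) ∧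
      φ ⟨f, hfJ⟩ ≤ 0 ∧ (∀ (a : A) (b : ↥(J ^ 2)), φ (a • b) = Φ a * φ b) ∧
      (∀ p ∈ M, 0 ≤ Φ p) ∧ ∃ u : ↥(J ^ 2), (u : A) ∈ M ∧ φ u = 1 := by
  have hhJ : ∀ i, h i ∈ J := fun i => hJ ▸ Ideal.subset_span ⟨i, rfl⟩
  have hh2 : ∀ i, h i ^ 2 ∈ J ^ 2 := fun i => Ideal.pow_mem_pow (hhJ i) 2
  let w : ι → ↥(J ^ 2) := fun i => ⟨h i ^ 2, hh2 i⟩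
  let u : ↥(J ^ 2) := ∑ i, w i
  have hu : (u : A) = ∑ i, h i ^ 2 := by simp [u, w]
  have huM : (u : A) ∈ M := by
    rw [hu]
    exact hM.sum_mem _ fun i _ => hM.sq_mem _
  obtain ⟨φ, hφ, hφu, hφf, hpure⟩ := exists_pure_state_nonpos (hM.cone (J ^ 2)) u huM
    (fun x => by
      obtain ⟨N, hN⟩ := hM.exists_smul_sub_mem harch h (b := x) (by rw [← hJ]; exact x.2)
      refine ⟨N, ?_⟩
      rw [hM.mem_cone, Submodule.coe_sub, coe_real_smul, hu, ← Algebra.smul_def]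
      exact hN) (f := ⟨f, hfJ⟩) hf
  have hφ' : ∀ b : ↥(J ^ 2), (b : A) ∈ M → 0 ≤ φ b := fun b hb => hφ b hb
  have hmul : ∀ (a : A) (b : ↥(J ^ 2)), φ (a • b) = φ (a • u) * φ b := by
    intro a b
    obtain ⟨K, hK, hle⟩ := exists_abs_state_smul_le hM harch hφ' a
    -- The bound `|φ (a b)| ≤ K φ b` places `ψ` between `0` and `φ` on the cone; purity gives `ψ = ψ
    -- u • φ`, which is solved for `φ (a b)`.
    let ψ : ↥(J ^ 2) →ₗ[ℝ] ℝ :=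
      { toFun := fun b => φ b / 2 + φ (a • b) / (2 * K)
        map_add' := fun x y => by simp only [smul_add, map_add]; ring
        map_smul' := fun c x => by
          simp only [smul_comm a c x, map_smul, smul_eq_mul, RingHom.id_apply]; ring }
    have hψ : ∀ b, ψ b = φ b / 2 + φ (a • b) / (2 * K) := fun _ => rfl
    have hψ' : ∀ b, 2 * K * ψ b = K * φ b + φ (a • b) := fun b => by
      rw [hψ]; field_simp
    have h1 := hpure ψ (fun x hx => ?_) (fun x hx => ?_) b
    · have h2 := hψ' b
      have h3 := hψ' u
      rw [hφu] at h3
      rw [h1, ← mul_assoc, h3] at h2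
      linarith
    · have h2 := abs_le.1 (hle x hx)
      have h3 := hψ' x
      have h4 : 0 ≤ 2 * K * ψ x := by rw [h3]; linarith
      exact nonneg_of_mul_nonneg_right h4 (by positivity)
    · have h2 := abs_le.1 (hle x hx)
      have h3 := hψ' x
      refine le_of_mul_le_mul_left (a := 2 * K) ?_ (by positivity)
      rw [h3]
      linarith
  let Φ : A →ₐ[ℝ] ℝ :=
    { toFun := fun a => φ (a • u)
      map_one' := by rw [one_smul, hφu]
      map_mul' := fun a b => by rw [mul_smul, hmul]
      map_zero' := by rw [zero_smul, map_zero]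
      map_add' := fun a b => by rw [add_smul, map_add]
      commutes' := fun r => by
        rw [algebraMap_smul, map_smul, hφu]
        simp }
  refine ⟨φ, Φ, hφ', hφf, hmul, fun p hp => ?_, u, huM, hφu⟩
  -- For `p ∈ M` the product `p * h i ^ 2` lies in `M`, so a square with `φ (h i ^ 2) > 0` detects
  -- the sign of `Φ p`.
  obtain ⟨i, hi⟩ : ∃ i, 0 < φ (w i) := by
    by_contra! hcon
    have h1 : φ u ≤ 0 := by
      simp only [u, map_sum]
      exact Finset.sum_nonpos fun i _ => hcon i
    rw [hφu] at h1
    linarith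
  have h1 : 0 ≤ φ (p • w i) := hφ' _ (by
    have := hM.sq_mul_mem (h i) hp
    rw [mul_comm] at this
    exact this)
  rw [hmul] at h1
  exact nonneg_of_mul_nonneg_left h1 hi

end PureStateIdeal
end PolyPos

/-! ### Local generators, heights and regular parameters. -/

namespace PolyPos
section LocalAlgebra

variable {A : Type*} [CommRing A]

theorem exists_notMem_forall_mul_mem {p : Ideal A} [p.IsPrime] {I J : Ideal A} (hJ : J.FG)
    (h : ∀ x ∈ J, ∃ s ∉ p, s * x ∈ I) : ∃ s ∉ p, ∀ x ∈ J, s * x ∈ I := by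
  classical
  obtain ⟨T, rfl⟩ := hJ
  have h' : ∀ x : T, ∃ s ∉ p, s * x ∈ I := fun x => h x (Ideal.subset_span x.2)
  choose s hs hsI using h'
  refine ⟨∏ x, s x, fun hmem => ?_, fun x hx => ?_⟩
  · obtain ⟨x, -, hx⟩ := (Ideal.IsPrime.prod_mem_iff).1 hmem
    exact hs x hx
  · induction hx using Submodule.span_induction with
    | mem x hx =>
      rw [← Finset.prod_erase_mul _ _ (Finset.mem_univ (⟨x, hx⟩ : T)), mul_assoc]
      exact I.mul_mem_left _ (hsI ⟨x, hx⟩)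
    | zero => simp
    | add x y _ _ hx hy => rw [mul_add]; exact I.add_mem hx hy
    | smul a x _ hx => rw [smul_eq_mul, mul_left_comm]; exact I.mul_mem_left _ hx

theorem exists_local_generators {p : Ideal A} [p.IsPrime] {J : Ideal A} (hJ : J.FG) {r : ℕ}
    (a : Fin r → Localization.AtPrime p)
    (ha : Ideal.span (Set.range a) = J.map (algebraMap A (Localization.AtPrime p))) :
    ∃ F : Fin r → A, (∀ i, F i ∈ J) ∧
      ∃ s ∉ p, ∀ x ∈ J, s * x ∈ Ideal.span (Set.range F) := by
  have haJ : ∀ i, ∃ x : J × p.primeCompl, a i * algebraMap A (Localization.AtPrime p) x.2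
      = algebraMap A (Localization.AtPrime p) x.1 := fun i =>
    (IsLocalization.mem_map_algebraMap_iff p.primeCompl _).1
      (ha ▸ Ideal.subset_span ⟨i, rfl⟩)
  choose x hx using haJ
  refine ⟨fun i => (x i).1, fun i => (x i).1.2, exists_notMem_forall_mul_mem hJ fun y hy => ?_⟩
  have hle : J.map (algebraMap A (Localization.AtPrime p)) ≤
      (Ideal.span (Set.range fun i => ((x i).1 : A))).map
        (algebraMap A (Localization.AtPrime p)) := by
    rw [← ha, Ideal.span_le]
    rintro _ ⟨i, rfl⟩
    have hu : IsUnit (algebraMap A (Localization.AtPrime p) (x i).2) :=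
      IsLocalization.map_units _ (x i).2
    rw [SetLike.mem_coe, ← Ideal.mul_unit_mem_iff_mem _ hu, hx]
    exact Ideal.mem_map_of_mem _ (Ideal.subset_span ⟨i, rfl⟩)
  obtain ⟨m, hm, h⟩ := (IsLocalization.algebraMap_mem_map_algebraMap_iff p.primeCompl _ _ _).1
    (hle (Ideal.mem_map_of_mem _ hy))
  exact ⟨m, hm, h⟩

/-- Turns the height of `J` at `p` into a bound on `P` itself, which can then be used at other
primes containing `P`. -/
theorem le_height_of_mem_minimalPrimes {p : Ideal A} [p.IsPrime] {J P : Ideal A}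
    (hP : P ∈ J.minimalPrimes) (hPp : P ≤ p) :
    (J.map (algebraMap A (Localization.AtPrime p))).height ≤ P.height := by
  have := hP.1.1
  rw [← IsLocalization.height_map_of_disjoint (S := Localization.AtPrime p) p.primeCompl P
    (Set.disjoint_left.2 fun x hx hxP => hx (hPp hxP))]
  exact Ideal.height_mono (Ideal.map_mono hP.1.2)

/-- Near a prime `p`, no minimal primes of `J` other than those below `p` occur. -/
theorem exists_notMem_forall_minimalPrimes_le [IsNoetherianRing A] (p : Ideal A) [p.IsPrime]
    (J : Ideal A) : ∃ s ∉ p, ∀ P ∈ J.minimalPrimes, s ∉ P → P ≤ p := by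
  classical
  have hfin := Ideal.finite_minimalPrimes_of_isNoetherianRing A J
  have h : ∀ P : Ideal A, ∃ t ∉ p, ¬ P ≤ p → t ∈ P := by
    intro P
    by_cases hP : P ≤ p
    · exact ⟨1, p.ne_top_iff_one.1 (Ideal.IsPrime.ne_top ‹_›), fun h => absurd hP h⟩
    · obtain ⟨t, ht, htp⟩ := SetLike.not_le_iff_exists.1 hP
      exact ⟨t, htp, fun _ => ht⟩
  choose t ht htP using h
  refine ⟨∏ P ∈ hfin.toFinset, t P, fun hmem => ?_, fun P hP hs => ?_⟩
  · obtain ⟨P, -, hP⟩ := (Ideal.IsPrime.prod_mem_iff).1 hmem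
    exact ht P hP
  · by_contra hPp
    exact hs (Ideal.mem_of_dvd _ (Finset.dvd_prod_of_mem t (hfin.mem_toFinset.2 hP)) (htP P hPp))

/-- A chain of `d` strict inclusions of primes above `I` starts at height at least `r`, and each
inclusion raises the height by at least one. -/
theorem add_le_ringKrullDim_of_le_height {I : Ideal A} {r d : ℕ}
    (hr : ∀ P : Ideal A, P.IsPrime → I ≤ P → (r : ℕ∞) ≤ P.height)
    (hd : (d : WithBot ℕ∞) ≤ ringKrullDim (A ⧸ I)) :
    ((r + d : ℕ) : WithBot ℕ∞) ≤ ringKrullDim A := by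
  rw [ringKrullDim_quotient, Order.le_krullDim_iff] at hd
  obtain ⟨l, rfl⟩ := hd
  have key : ∀ (k : ℕ) (hk : k < l.length + 1),
      ((r + k : ℕ) : ℕ∞) ≤ (l ⟨k, hk⟩).1.asIdeal.height := by
    intro k
    induction k with
    | zero => exact fun hk => hr _ (l ⟨0, hk⟩).1.2 (l ⟨0, hk⟩).2
    | succ k ih =>
      intro hk
      have h1 := ih (by lia)
      have hlt : (l ⟨k, by lia⟩).1.asIdeal < (l ⟨k + 1, hk⟩).1.asIdeal :=
        l.strictMono (Fin.mk_lt_mk.2 (Nat.lt_succ_self k))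
      have h2 := Ideal.height_add_one_le_of_lt_of_isPrime hlt
      refine le_trans ?_ h2
      rw [← add_assoc, Nat.cast_succ]
      gcongr
  refine le_trans ?_ (Ideal.height_le_ringKrullDim_of_isPrime
    (I := (l ⟨l.length, by lia⟩).1.asIdeal))
  exact_mod_cast key l.length (by lia)

theorem add_le_height_of_le_height {m J : Ideal A} [m.IsPrime] {r d : ℕ}
    (hr : ∀ P ∈ J.minimalPrimes, P ≤ m → (r : ℕ∞) ≤ P.height)
    (hd : (d : WithBot ℕ∞) ≤ ringKrullDim (Localization.AtPrime m ⧸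
      J.map (algebraMap A (Localization.AtPrime m)))) : ((r + d : ℕ) : ℕ∞) ≤ m.height := by
  have h := add_le_ringKrullDim_of_le_height (r := r) (fun P hP hle => ?_) hd
  · rw [IsLocalization.AtPrime.ringKrullDim_eq_height m] at h
    exact_mod_cast h
  · rw [← IsLocalization.height_under m.primeCompl P]
    obtain ⟨Q, hQ, hQP⟩ := Ideal.exists_minimalPrimes_le (I := J) (J := P.under A)
      (Ideal.map_le_iff_le_comap.1 hle)
    refine (hr Q hQ (hQP.trans ?_)).trans (Ideal.height_mono hQP)
    exact (Ideal.comap_mono (IsLocalRing.le_maximalIdeal hP.ne_top)).trans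
      (Localization.AtPrime.under_maximalIdeal (I := m)).le

/-- If `A_m / J A_m` is regular of dimension `d`, then `m` is generated modulo `J`, locally at `m`,
by `d` elements. -/
theorem exists_local_parameters {m J : Ideal A} [m.IsPrime]
    (hreg : IsRegularLocalRing (Localization.AtPrime m ⧸
      J.map (algebraMap A (Localization.AtPrime m)))) :
    ∃ (d : ℕ) (y : Fin d → A), (∀ i, y i ∈ m) ∧
      (d : WithBot ℕ∞) ≤ ringKrullDim (Localization.AtPrime m ⧸
        J.map (algebraMap A (Localization.AtPrime m))) ∧
      ∀ x ∈ m, ∃ s ∉ m, s * x ∈ Ideal.span (Set.range y) ⊔ J := by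
  set L := Localization.AtPrime m
  set K := J.map (algebraMap A L) with hK
  set π := Ideal.Quotient.mk K
  have hcomap : (IsLocalRing.maximalIdeal (L ⧸ K)).comap π = IsLocalRing.maximalIdeal L :=
    IsLocalRing.eq_maximalIdeal
      (Ideal.comap_isMaximal_of_surjective π Ideal.Quotient.mk_surjective)
  have hunder : (IsLocalRing.maximalIdeal L).comap (algebraMap A L) = m :=
    Localization.AtPrime.under_maximalIdeal (I := m)
  obtain ⟨T, hTcard, hT⟩ := Submodule.FG.exists_span_finset_card_eq_spanFinrank
    (IsNoetherian.noetherian (IsLocalRing.maximalIdeal (L ⧸ K)))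
  have hlift : ∀ t : T, ∃ y ∈ m, ∃ v : L, IsUnit v ∧ (t : L ⧸ K) * π v = π (algebraMap A L y) := by
    rintro ⟨t, ht⟩
    obtain ⟨x, rfl⟩ := Ideal.Quotient.mk_surjective t
    obtain ⟨⟨y, s⟩, hy⟩ := IsLocalization.surj m.primeCompl x
    refine ⟨y, ?_, algebraMap A L s, IsLocalization.map_units _ s, ?_⟩
    · have h1 : π x ∈ IsLocalRing.maximalIdeal (L ⧸ K) := hT ▸ Submodule.subset_span ht
      have h2 : x ∈ IsLocalRing.maximalIdeal L := hcomap ▸ h1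
      rw [← hunder, Ideal.mem_comap]
      have hy' : x * algebraMap A L s = algebraMap A L y := hy
      rw [← hy']
      exact Ideal.mul_mem_right _ _ h2
    · rw [← map_mul]
      exact congrArg π hy
  choose y hym v hv hy using hlift
  let e := T.equivFin
  refine ⟨T.card, fun i => y (e.symm i), fun i => hym _, ?_, fun x hx => ?_⟩
  · rw [hTcard, IsRegularLocalRing.spanFinrank_maximalIdeal]
  have hle : IsLocalRing.maximalIdeal (L ⧸ K) ≤
      ((Ideal.span (Set.range fun i => y (e.symm i))).map (algebraMap A L)).map π := by
    rw [← hT]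
    refine Submodule.span_le.2 fun t ht => ?_
    rw [SetLike.mem_coe, ← Ideal.mul_unit_mem_iff_mem _ ((hv ⟨t, ht⟩).map π), hy ⟨t, ht⟩]
    exact Ideal.mem_map_of_mem _ (Ideal.mem_map_of_mem _
      (Ideal.subset_span ⟨e ⟨t, ht⟩, by simp⟩))
  have h1 : π (algebraMap A L x) ∈ IsLocalRing.maximalIdeal (L ⧸ K) := by
    rw [← Ideal.mem_comap, hcomap, ← Ideal.mem_comap, hunder]
    exact hx
  have h2 := Ideal.mem_quotient_iff_mem_sup.1 (hle h1)
  have h3 : algebraMap A L x ∈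
      (Ideal.span (Set.range fun i => y (e.symm i)) ⊔ J).map (algebraMap A L) := by
    rw [Ideal.map_sup]
    exact h2
  obtain ⟨s, hs, h⟩ := (IsLocalization.algebraMap_mem_map_algebraMap_iff m.primeCompl _ _ _).1 h3
  exact ⟨s, hs, h⟩

end LocalAlgebra
end PolyPos

/-! ### Gradients, local frames and membership in `J ^ 2`. -/

namespace PolyPos
open MvPolynomial
section Gradients

variable {n : ℕ}

theorem mem_pointIdeal {z : Fin n → ℝ} {p : MvPolynomial (Fin n) ℝ} :
    p ∈ pointIdeal z ↔ eval z p = 0 := RingHom.mem_ker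

theorem grad_add (p q : MvPolynomial (Fin n) ℝ) (z : Fin n → ℝ) :
    grad (p + q) z = grad p z + grad q z := by
  ext i; simp [grad]

theorem grad_mul (p q : MvPolynomial (Fin n) ℝ) (z : Fin n → ℝ) :
    grad (p * q) z = eval z p • grad q z + eval z q • grad p z := by
  ext i; simp [grad]

theorem grad_sum {ι : Type*} (s : Finset ι) (p : ι → MvPolynomial (Fin n) ℝ) (z : Fin n → ℝ) :
    grad (∑ i ∈ s, p i) z = ∑ i ∈ s, grad (p i) z := by
  ext j; simp [grad]

theorem grad_X_sub_C (i : Fin n) (c : ℝ) (z : Fin n → ℝ) :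
    grad (X i - C c) z = Pi.single i 1 := by
  ext j
  simp [grad, pderiv_X, Pi.single_apply, apply_ite, eq_comm]

theorem grad_sum_mul_of_eval_eq_zero {ι : Type*} [Fintype ι] {z : Fin n → ℝ}
    {F : ι → MvPolynomial (Fin n) ℝ} (hF : ∀ i, eval z (F i) = 0)
    (c : ι → MvPolynomial (Fin n) ℝ) :
    grad (∑ i, c i * F i) z = ∑ i, eval z (c i) • grad (F i) z := by
  simp [grad_sum, grad_mul, hF]

theorem grad_mem_span_of_mem_span {ι : Type*} [Fintype ι] {z : Fin n → ℝ}
    {F : ι → MvPolynomial (Fin n) ℝ} (hF : ∀ i, eval z (F i) = 0)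
    {p : MvPolynomial (Fin n) ℝ} (hp : p ∈ Ideal.span (Set.range F)) :
    grad p z ∈ Submodule.span ℝ (Set.range fun i => grad (F i) z) := by
  obtain ⟨c, rfl⟩ := Ideal.mem_span_range_iff_exists_fun.1 hp
  rw [grad_sum_mul_of_eval_eq_zero hF]
  exact Submodule.sum_mem _ fun i _ => Submodule.smul_mem _ _ (Submodule.subset_span ⟨i, rfl⟩)

/-- At a nonsingular point, local generators of `J` whose number is at most the height of `J` have
linearly independent gradients. -/
theorem linearIndependent_grad {J : Ideal (MvPolynomial (Fin n) ℝ)} {z : Fin n → ℝ}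
    (hz : J ≤ pointIdeal z) (hns : IsNonsingularAt J z) {r : ℕ}
    {F : Fin r → MvPolynomial (Fin n) ℝ} (hF : ∀ i, F i ∈ J) {s : MvPolynomial (Fin n) ℝ}
    (hs : eval z s ≠ 0) (hsJ : ∀ x ∈ J, s * x ∈ Ideal.span (Set.range F))
    (hr : ∀ P ∈ J.minimalPrimes, P ≤ pointIdeal z → (r : ℕ∞) ≤ P.height) :
    LinearIndependent ℝ fun i => grad (F i) z := by
  obtain ⟨d, y, hy, hd, hyJ⟩ := exists_local_parameters hns
  have hrd : r + d ≤ n := by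
    have h1 := add_le_height_of_le_height hr hd
    have h2 : ((pointIdeal z).height : WithBot ℕ∞) ≤ n := by
      refine Ideal.height_le_ringKrullDim_of_isPrime.trans ?_
      rw [MvPolynomial.ringKrullDim_of_isNoetherianRing, ringKrullDim_eq_zero_of_field]
      simp
    exact_mod_cast (WithBot.coe_le_coe.2 h1).trans h2
  have hJz : ∀ x ∈ J, eval z x = 0 := fun x hx => mem_pointIdeal.1 (hz hx)
  set U := Submodule.span ℝ (Set.range fun i => grad (y i) z)
  set W := Submodule.span ℝ (Set.range fun i => grad (F i) z)
  have hJW : ∀ x ∈ J, grad x z ∈ W := by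
    intro x hx
    have h1 := grad_mem_span_of_mem_span (fun i => hJz _ (hF i)) (hsJ x hx)
    rw [grad_mul, hJz x hx, zero_smul, add_zero] at h1
    exact (Submodule.smul_mem_iff _ hs).1 h1
  -- The coordinate functions `X i - z i` lie locally in the ideal of the `y i` and `J`, so every
  -- basis vector lies in `U ⊔ W`. As `dim U ≤ d` and `r + d ≤ n`, this leaves `dim W ≥ r`.
  have htop : U ⊔ W = ⊤ := by
    rw [eq_top_iff, ← (Pi.basisFun ℝ (Fin n)).span_eq, Submodule.span_le]
    rintro _ ⟨i, rfl⟩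
    have hx : X i - C (z i) ∈ pointIdeal z := by simp [mem_pointIdeal]
    obtain ⟨t, ht, h⟩ := hyJ _ hx
    obtain ⟨a, ha, b, hb, hab⟩ := Submodule.mem_sup.1 h
    have h1 := congrArg (fun p => grad p z) hab
    simp only [grad_add, grad_mul t, mem_pointIdeal.1 hx, zero_smul, add_zero,
      grad_X_sub_C] at h1
    have h2 : eval z t • (Pi.single i 1 : Fin n → ℝ) ∈ U ⊔ W := by
      rw [← h1]
      exact Submodule.add_mem_sup
        (grad_mem_span_of_mem_span (fun i => mem_pointIdeal.1 (hy i)) ha) (hJW b hb)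
    rw [Pi.basisFun_apply]
    exact (Submodule.smul_mem_iff _ (mt mem_pointIdeal.2 ht)).1 h2
  have h1 := Submodule.finrank_add_le_finrank_add_finrank U W
  rw [htop, finrank_top, Module.finrank_fin_fun] at h1
  have h2 : Module.finrank ℝ U ≤ d :=
    (finrank_range_le_card (R := ℝ) fun i => grad (y i) z).trans_eq (Fintype.card_fin d)
  rw [linearIndependent_iff_card_le_finrank_span, Fintype.card_fin]
  change r ≤ Module.finrank ℝ W
  lia

theorem mem_closureIdeal {Z : Set (Fin n → ℝ)} {p : MvPolynomial (Fin n) ℝ} :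
    p ∈ closureIdeal Z ↔ ∀ z ∈ Z, eval z p = 0 := by
  simp [closureIdeal, mem_vanishingIdeal_iff, aeval_eq_eval]

/-- Local generators of the ideal `J` of a nonsingular real point set on a local complete
intersection. -/
theorem exists_local_frame {Z : Set (Fin n → ℝ)} {J : Ideal (MvPolynomial (Fin n) ℝ)}
    (hJ : J = closureIdeal Z) (hlci : IsLocalCompleteIntersection J)
    (hns : ∀ z ∈ Z, IsNonsingularAt J z) (p : Ideal (MvPolynomial (Fin n) ℝ)) [p.IsPrime]
    (hp : J ≤ p) :
    ∃ (r : ℕ) (F : Fin r → MvPolynomial (Fin n) ℝ), (∀ i, F i ∈ J) ∧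
      ∃ s ∉ p, (∀ x ∈ J, s * x ∈ Ideal.span (Set.range F)) ∧
        ∀ z ∈ Z, eval z s ≠ 0 → LinearIndependent ℝ fun i => grad (F i) z := by
  obtain ⟨r, a, ha, hr⟩ := hlci p hp
  obtain ⟨F, hF, s, hs, hsJ⟩ := exists_local_generators (IsNoetherian.noetherian J) a ha
  obtain ⟨t, ht, htP⟩ := exists_notMem_forall_minimalPrimes_le p J
  have hsJ' : ∀ x ∈ J, s * t * x ∈ Ideal.span (Set.range F) := fun x hx => by
    rw [mul_right_comm]
    exact Ideal.mul_mem_right _ _ (hsJ x hx)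
  -- Where `t` does not vanish, every minimal prime of `J` through `z` lies below `p` and so has
  -- height at least `r`. Thus generators found at `p` also serve at nearby points of `Z`.
  refine ⟨r, F, hF, s * t, ?_, hsJ', fun z hz hst => ?_⟩
  · exact fun h => (Ideal.IsPrime.mem_or_mem ‹_› h).elim hs ht
  have hJz : J ≤ pointIdeal z := fun x hx => by
    rw [hJ] at hx
    exact mem_pointIdeal.2 (mem_closureIdeal.1 hx z hz)
  refine linearIndependent_grad hJz (hns z hz) hF hst hsJ' fun P hP hPz => ?_
  rw [hr]
  refine le_height_of_mem_minimalPrimes hP (htP P hP fun htP' => hst ?_)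
  rw [map_mul, mem_pointIdeal.1 (hPz htP'), mul_zero]

/-- On a local complete intersection with dense nonsingular real points, a polynomial which vanishes
to second order at these points lies in the square of the ideal. -/
theorem mem_sq_of_grad_eq_zero {Z : Set (Fin n → ℝ)} {J : Ideal (MvPolynomial (Fin n) ℝ)}
    (hJ : J = closureIdeal Z) (hlci : IsLocalCompleteIntersection J)
    (hns : ∀ z ∈ Z, IsNonsingularAt J z) {f : MvPolynomial (Fin n) ℝ}
    (hf : ∀ z ∈ Z, eval z f = 0) (hgrad : ∀ z ∈ Z, grad f z = 0) : f ∈ J ^ 2 := by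
  by_contra hcon
  have hmem : ∀ {t}, t ∈ (J ^ 2).colon {f} ↔ t * f ∈ J ^ 2 := Submodule.mem_colon_singleton
  -- Membership in `J ^ 2` is tested at maximal ideals, which need not come from real points.
  obtain ⟨p, hpmax, hp⟩ := Ideal.exists_le_maximal ((J ^ 2).colon {f}) (fun h => hcon (by
    have := hmem.1 ((Ideal.eq_top_iff_one _).1 h)
    rwa [one_mul] at this))
  have := hpmax.isPrime
  by_cases hJp : J ≤ p
  · obtain ⟨r, F, hF, s, hs, hsJ, hli⟩ := exists_local_frame hJ hlci hns p hJp
    have hfJ : f ∈ J := hJ ▸ mem_closureIdeal.2 hf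
    have hFz : ∀ z ∈ Z, ∀ i, eval z (F i) = 0 := fun z hz i =>
      mem_closureIdeal.1 (hJ ▸ hF i) z hz
    obtain ⟨c, hc⟩ := Ideal.mem_span_range_iff_exists_fun.1 (hsJ f hfJ)
    -- At `z ∈ Z` the gradient of `s * f = ∑ c i * F i` is zero, so independence gives `c i (z) = 0`
    -- unless `s(z) = 0`. As `J` is the full vanishing ideal of `Z`, this suffices.
    have hsc : ∀ i, s * c i ∈ J := by
      intro i
      rw [hJ, mem_closureIdeal]
      intro z hz
      rw [map_mul]
      by_cases hsz : eval z s = 0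
      · rw [hsz, zero_mul]
      · have h1 := congrArg (fun p => grad p z) hc
        simp only [grad_sum_mul_of_eval_eq_zero (hFz z hz), grad_mul s, hf z hz, hgrad z hz,
          smul_zero, zero_smul, add_zero] at h1
        rw [Fintype.linearIndependent_iff.1 (hli z hz hsz) _ h1 i, mul_zero]
    have hss : s * s ∈ p := hp (hmem.2 (by
      rw [mul_assoc, ← hc, Finset.mul_sum, pow_two]
      refine Ideal.sum_mem _ fun i _ => ?_
      rw [← mul_assoc]
      exact Ideal.mul_mem_mul (hsc i) (hF i)))
    exact (this.mem_or_mem hss).elim hs hs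
  · obtain ⟨j, hj, hjp⟩ := SetLike.not_le_iff_exists.1 hJp
    have hjj : j ^ 2 ∈ p := hp (hmem.2 (Ideal.mul_mem_right _ _ (Ideal.pow_mem_pow hj 2)))
    exact hjp (this.mem_of_pow_mem _ hjj)

end Gradients
end PolyPos

/-! ### Hessians and positivity of states at a point. -/

namespace PolyPos
open MvPolynomial
section Hessians

variable {n : ℕ}

theorem D2_eq_sum (f : MvPolynomial (Fin n) ℝ) (z v : Fin n → ℝ) :
    D2 f z v v = ∑ i, ∑ j, v i * v j * eval z (pderiv i (pderiv j f)) := by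
  simp only [D2, hessian, dotProduct, Matrix.mulVec, Matrix.of_apply, Finset.mul_sum]
  exact Finset.sum_congr rfl fun i _ => Finset.sum_congr rfl fun j _ => by ring

theorem D2_sum {ι : Type*} (s : Finset ι) (p : ι → MvPolynomial (Fin n) ℝ) (z v : Fin n → ℝ) :
    D2 (∑ k ∈ s, p k) z v v = ∑ k ∈ s, D2 (p k) z v v := by
  simp only [D2_eq_sum, map_sum, Finset.mul_sum]
  rw [eq_comm, Finset.sum_comm]
  exact Finset.sum_congr rfl fun i _ => Finset.sum_comm

theorem D2_mul (p q : MvPolynomial (Fin n) ℝ) (z v : Fin n → ℝ) :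
    D2 (p * q) z v v = eval z p * D2 q z v v + eval z q * D2 p z v v +
      2 * ((grad p z ⬝ᵥ v) * (grad q z ⬝ᵥ v)) := by
  have h : (grad p z ⬝ᵥ v) * (grad q z ⬝ᵥ v) =
      ∑ i, ∑ j, v i * v j * (eval z (pderiv i p) * eval z (pderiv j q)) := by
    simp only [dotProduct, grad, Finset.sum_mul_sum]
    exact Finset.sum_congr rfl fun i _ => Finset.sum_congr rfl fun j _ => by ring
  have h' : (grad p z ⬝ᵥ v) * (grad q z ⬝ᵥ v) =
      ∑ i, ∑ j, v i * v j * (eval z (pderiv j p) * eval z (pderiv i q)) := by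
    rw [h, Finset.sum_comm]
    exact Finset.sum_congr rfl fun i _ => Finset.sum_congr rfl fun j _ => by ring
  rw [two_mul]
  nth_rewrite 1 [h]
  rw [h']
  simp only [D2_eq_sum, Finset.mul_sum, ← Finset.sum_add_distrib]
  refine Finset.sum_congr rfl fun i _ => Finset.sum_congr rfl fun j _ => ?_
  simp only [Derivation.leibniz, map_add, smul_eq_mul, map_mul]
  ring

theorem exists_dotProduct_eq_of_linearIndependent {r : ℕ} {w : Fin r → Fin n → ℝ}
    (hw : LinearIndependent ℝ w) (ξ : Fin r → ℝ) : ∃ v, ∀ i, w i ⬝ᵥ v = ξ i := by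
  have h1 : (Matrix.of w).rank = r := by
    simpa using LinearIndependent.rank_matrix (M := Matrix.of w) hw
  have h2 : LinearMap.range (Matrix.of w).mulVecLin = ⊤ := by
    apply Submodule.eq_top_of_finrank_eq
    rw [Module.finrank_fin_fun]
    exact h1
  obtain ⟨v, hv⟩ := LinearMap.range_eq_top.1 h2 ξ
  exact ⟨v, fun i => congrFun hv i⟩

/-- The trace pairing of a positive definite form with a nonzero positive semidefinite matrix is
positive. -/
theorem sum_mul_pos_of_posSemidef {r : ℕ} {a C : Matrix (Fin r) (Fin r) ℝ}
    (ha : ∀ ξ : Fin r → ℝ, ξ ≠ 0 → 0 < ∑ i, ∑ j, a i j * (ξ i * ξ j)) (hC : C.PosSemidef)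
    (hC0 : C ≠ 0) : 0 < ∑ i, ∑ j, a i j * C i j := by
  obtain ⟨m, v, rfl⟩ := Matrix.posSemidef_iff_eq_sum_vecMulVec.1 hC
  have h : ∑ i, ∑ j, a i j * (∑ k, Matrix.vecMulVec (v k) (star (v k))) i j
      = ∑ k, ∑ i, ∑ j, a i j * (v k i * v k j) := by
    simp only [Matrix.sum_apply, Matrix.vecMulVec_apply, Finset.mul_sum, star_trivial]
    rw [eq_comm, Finset.sum_comm]
    exact Finset.sum_congr rfl fun i _ => Finset.sum_comm
  rw [h]
  have hnn : ∀ k, 0 ≤ ∑ i, ∑ j, a i j * (v k i * v k j) := fun k => by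
    by_cases hk : v k = 0
    · simp [hk]
    · exact (ha _ hk).le
  obtain ⟨k, hk⟩ : ∃ k, v k ≠ 0 := by
    by_contra! hcon
    exact hC0 (by simp [hcon])
  exact Finset.sum_pos' (fun k _ => hnn k) ⟨k, Finset.mem_univ k, ha _ hk⟩

/-- One factor `s` is spent on each of the two factors of a product in `J * J`. -/
theorem exists_sq_mul_eq_sum {A : Type*} [CommRing A] {J : Ideal A} {r : ℕ} {F : Fin r → A} {s : A}
    (hsJ : ∀ x ∈ J, s * x ∈ Ideal.span (Set.range F)) {b : A} (hb : b ∈ J ^ 2) :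
    ∃ a : Fin r → Fin r → A, s ^ 2 * b = ∑ i, ∑ j, a i j * (F i * F j) := by
  rw [pow_two] at hb
  refine Submodule.mul_induction_on hb ?_ ?_
  · intro x hx y hy
    obtain ⟨c, hc⟩ := Ideal.mem_span_range_iff_exists_fun.1 (hsJ x hx)
    obtain ⟨d, hd⟩ := Ideal.mem_span_range_iff_exists_fun.1 (hsJ y hy)
    refine ⟨fun i j => c i * d j, ?_⟩
    have h1 : s ^ 2 * (x * y) = (s * x) * (s * y) := by ring
    rw [h1, ← hc, ← hd, Finset.sum_mul_sum]
    exact Finset.sum_congr rfl fun i _ => Finset.sum_congr rfl fun j _ => by ring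
  · rintro x y ⟨c, hc⟩ ⟨d, hd⟩
    refine ⟨fun i j => c i j + d i j, ?_⟩
    simp only [mul_add, hc, hd, add_mul, Finset.sum_add_distrib]

/-- A nonzero state of `J ^ 2` supported at `z` is positive at `f`, if the Hessian of `f` at `z` is
positive in the directions normal to `J`. -/
theorem state_pos_of_hessian {J : Ideal (MvPolynomial (Fin n) ℝ)} {z : Fin n → ℝ}
    (hz : J ≤ pointIdeal z) {r : ℕ} {F : Fin r → MvPolynomial (Fin n) ℝ} (hF : ∀ i, F i ∈ J)
    {s : MvPolynomial (Fin n) ℝ} (hs : eval z s ≠ 0)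
    (hsJ : ∀ x ∈ J, s * x ∈ Ideal.span (Set.range F))
    (hli : LinearIndependent ℝ fun i => grad (F i) z)
    {f : MvPolynomial (Fin n) ℝ} (hfJ : f ∈ J ^ 2) (hgrad : grad f z = 0)
    (hhess : ∀ v, v ∉ tangentSpace J z → 0 < D2 f z v v) {φ : ↥(J ^ 2) →ₗ[ℝ] ℝ}
    (hsq : ∀ b : ↥(J ^ 2), IsSquare (b : MvPolynomial (Fin n) ℝ) → 0 ≤ φ b)
    (hmul : ∀ (a : MvPolynomial (Fin n) ℝ) (b : ↥(J ^ 2)), φ (a • b) = eval z a * φ b)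
    (hne : φ ≠ 0) : 0 < φ ⟨f, hfJ⟩ := by
  have hF0 : ∀ i, eval z (F i) = 0 := fun i => mem_pointIdeal.1 (hz (hF i))
  have hf0 : eval z f = 0 := mem_pointIdeal.1 (hz (Ideal.pow_le_self two_ne_zero hfJ))
  have hmem : ∀ i j, F i * F j ∈ J ^ 2 := fun i j => by
    rw [pow_two]; exact Ideal.mul_mem_mul (hF i) (hF j)
  let W : Fin r → Fin r → ↥(J ^ 2) := fun i j => ⟨F i * F j, hmem i j⟩
  let B : Matrix (Fin r) (Fin r) ℝ := Matrix.of fun i j => φ (W i j)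
  have hφB : ∀ (b : ↥(J ^ 2)) (a : Fin r → Fin r → MvPolynomial (Fin n) ℝ),
      s ^ 2 * (b : MvPolynomial (Fin n) ℝ) = ∑ i, ∑ j, a i j * (F i * F j) →
      eval z s ^ 2 * φ b = ∑ i, ∑ j, eval z (a i j) * B i j := by
    intro b a hab
    have h1 : s ^ 2 • b = ∑ i, ∑ j, a i j • W i j := by
      ext1
      simp only [Submodule.coe_smul, Submodule.coe_sum, smul_eq_mul, W]
      exact hab
    have h2 := congrArg φ h1
    simp only [hmul, map_sum, map_pow] at h2
    exact h2
  have hB : B.PosSemidef := by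
    refine Matrix.PosSemidef.of_dotProduct_mulVec_nonneg ?_ fun ξ => ?_
    · ext i j
      simp [B, W, mul_comm]
    · have h1 := hsq (∑ i, ∑ j, (ξ i * ξ j) • W i j) (by
        refine ⟨∑ i, C (ξ i) * F i, ?_⟩
        simp only [Submodule.coe_sum, coe_real_smul, W, Finset.sum_mul_sum, algebraMap_eq, map_mul]
        exact Finset.sum_congr rfl fun i _ => Finset.sum_congr rfl fun j _ => by ring)
      refine h1.trans_eq ?_
      simp only [map_sum, φ.map_smul, dotProduct, Matrix.mulVec, Finset.mul_sum, star_trivial, B,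
        Matrix.of_apply, smul_eq_mul]
      exact Finset.sum_congr rfl fun i _ => Finset.sum_congr rfl fun j _ => by ring
  -- Since `s(z) ≠ 0`, the matrix `B` determines `φ` on all of `J ^ 2`.
  have hB0 : B ≠ 0 := by
    intro h0
    refine hne (LinearMap.ext fun b => ?_)
    obtain ⟨a, ha⟩ := exists_sq_mul_eq_sum hsJ b.2
    have h1 := hφB b a ha
    rw [h0] at h1
    simpa [hs] using h1
  obtain ⟨a, ha⟩ := exists_sq_mul_eq_sum hsJ hfJ
  -- As `f`, its gradient and all `F i` vanish at `z`, only the cross terms of the product rule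
  -- survive.
  have hD : ∀ v, eval z s ^ 2 * D2 f z v v =
      2 * ∑ i, ∑ j, eval z (a i j) * ((grad (F i) z ⬝ᵥ v) * (grad (F j) z ⬝ᵥ v)) := by
    intro v
    have h1 := congrArg (fun p => D2 p z v v) ha
    simp only [D2_mul (s ^ 2), hf0, hgrad, zero_dotProduct, mul_zero, zero_mul, add_zero, D2_sum,
      map_pow] at h1
    rw [h1]
    simp only [Finset.mul_sum]
    refine Finset.sum_congr rfl fun i _ => Finset.sum_congr rfl fun j _ => ?_
    simp only [D2_mul, grad_mul, map_mul, hF0, zero_smul, zero_dotProduct, mul_zero,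
      zero_mul, add_zero, zero_add]
    ring
  have h1 := hφB ⟨f, hfJ⟩ a ha
  have h2 := sum_mul_pos_of_posSemidef (a := Matrix.of fun i j => eval z (a i j)) (fun ξ hξ => ?_)
    hB hB0
  · simp only [Matrix.of_apply] at h2
    rw [← h1] at h2
    exact pos_of_mul_pos_right h2 (sq_nonneg _)
  -- Independent gradients let every `ξ` be realized as the normal components of some `v`; `ξ ≠ 0`
  -- makes `v` non-tangent, so the Hessian condition gives positive definiteness.
  · obtain ⟨v, hv⟩ := exists_dotProduct_eq_of_linearIndependent hli ξ
    have h3 := hD v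
    simp only [hv] at h3
    have hvT : v ∉ tangentSpace J z := fun h => hξ (funext fun i => by
      rw [← hv i]
      exact h _ (hF i))
    have h4 : 0 < eval z s ^ 2 * D2 f z v v := mul_pos (by positivity) (hhess v hvT)
    simp only [Matrix.of_apply]
    linarith

end Hessians
end PolyPos

/-! ### The main theorem. -/

theorem mainTheorem2 {n m : ℕ} (g : Fin m → MvPolynomial (Fin n) ℝ)
    (M : Set (MvPolynomial (Fin n) ℝ)) (hM : M = PolyPos.QM g)
    (harch : PolyPos.IsArchimedean M)
    (f : MvPolynomial (Fin n) ℝ)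
    (hf : ∀ x ∈ PolyPos.nonnegSet M, 0 ≤ MvPolynomial.eval x f)
    (J : Ideal (MvPolynomial (Fin n) ℝ))
    (hJ : J = PolyPos.closureIdeal (PolyPos.zeroSet f ∩ PolyPos.nonnegSet M))
    (hlci : PolyPos.IsLocalCompleteIntersection J)
    (hnonsing : ∀ z ∈ PolyPos.zeroSet f ∩ PolyPos.nonnegSet M, PolyPos.IsNonsingularAt J z)
    (hgrad : ∀ z ∈ PolyPos.zeroSet f ∩ PolyPos.nonnegSet M, PolyPos.grad f z = 0)
    (hhess : ∀ z ∈ PolyPos.zeroSet f ∩ PolyPos.nonnegSet M, ∀ v : Fin n → ℝ,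
      v ∉ PolyPos.tangentSpace J z → 0 < PolyPos.D2 f z v v) :
    f ∈ M := by
  have hMq : PolyPos.IsQuadraticModule M := hM ▸ PolyPos.isQuadraticModule_QM g
  have hfJ : f ∈ J ^ 2 :=
    PolyPos.mem_sq_of_grad_eq_zero hJ hlci hnonsing (fun z hz => hz.1) hgrad
  by_contra hfM
  obtain ⟨k, h, hh⟩ := Submodule.fg_iff_exists_fin_generating_family.1
    (IsNoetherian.noetherian J)
  obtain ⟨φ, Φ, hφ, hφf, hmul, hΦ, u, huM, hu⟩ :=
    PolyPos.exists_multiplicative_state_nonpos hMq harch h hh.symm hfJ hfM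
  obtain ⟨z, rfl⟩ : ∃ z : Fin n → ℝ, Φ = MvPolynomial.aeval z :=
    ⟨_, MvPolynomial.aeval_unique Φ⟩
  simp only [MvPolynomial.aeval_eq_eval] at hmul hΦ
  -- Both `f` and `u` lie in `J ^ 2`, so either can act as the scalar in `φ (f u)`, and `φ u = 1`.
  -- With `u(z) ≥ 0` and `φ f ≤ 0` this yields `f(z) ≤ 0`.
  have hfu : MvPolynomial.eval z f = MvPolynomial.eval z u * φ ⟨f, hfJ⟩ := by
    have h1 : f • u = (u : MvPolynomial (Fin n) ℝ) • (⟨f, hfJ⟩ : ↥(J ^ 2)) := by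
      ext1
      exact mul_comm _ _
    have h2 := congrArg φ h1
    rwa [hmul, hmul, hu, mul_one] at h2
  have hfz : MvPolynomial.eval z f = 0 := by
    refine le_antisymm ?_ (hf z hΦ)
    rw [hfu]
    exact mul_nonpos_of_nonneg_of_nonpos (hΦ _ huM) hφf
  have hz : z ∈ PolyPos.zeroSet f ∩ PolyPos.nonnegSet M := ⟨hfz, hΦ⟩
  have hJz : J ≤ PolyPos.pointIdeal z := fun x hx =>
    PolyPos.mem_pointIdeal.2 (PolyPos.mem_closureIdeal.1 (hJ ▸ hx) z hz)
  obtain ⟨r, F, hF, s, hs, hsJ, hli⟩ :=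
    PolyPos.exists_local_frame hJ hlci hnonsing (PolyPos.pointIdeal z) hJz
  have hsz : MvPolynomial.eval z s ≠ 0 := mt PolyPos.mem_pointIdeal.2 hs
  refine absurd (PolyPos.state_pos_of_hessian hJz hF hsz hsJ (hli z hz hsz) hfJ (hgrad z hz)
    (hhess z hz) (fun b hb => hφ b ?_) hmul ?_) hφf.not_gt
  · obtain ⟨c, hc⟩ := hb
    rw [hc, ← pow_two]
    exact hMq.sq_mem c
  · rintro rfl
    simp at hu
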